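/- Let $X$ be a sequentially complete Hausdorff locally convex space over $\mathbb T\in\{\mathbb R,\mathbb C\}$ whose topology is generated by seminorms $\|\cdot\|_\alpha$, $\alpha\in\Omega$, and let $\mathcal L(X)$ be the space of continuous linear operators on $X$. A set $\mathcal G\subset\mathcal L(X)$ is equicontinuous if for every $\alpha\in\Omega$ there are finitely many $\alpha_i\in\Omega$ and $b_i>0$ with $\|Gx\|_\alpha\le\sum_i b_i\|x\|_{\alpha_i}$ for all $G\in\mathcal G$, $x\in X$. Let $\mathcal E_X$ be the set of all $F:[0,\infty)\to\mathcal L(X)$ with $F(0)=I$ such that for every $s\ge0$ the family $\{F(d/n)^m : n,m\in\{1,2,\dots\},\ d\ge0,\ md/n\le s\}$ is equicontinuous. For $F:[0,\infty)\to\mathcal L(X)$ let $F'_{mef}(0)$ be the set of all pairs $(f,g)\in X\times X$ for which there are $f_h\in X$, $h\ge0$, with $f_h\to f$ and $h^{-1}(F(h)-F(0))f_h\to g$ as $h\downarrow0$; its domain is the set of the first components $f$. Let $\mathcal F_X$ be the set of all $F\in\mathcal E_X$ for which this domain is dense in $X$. For $F\in\mathcal F_X$ the relation $F'_{mef}(0)$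 is single-valued, and the linear operator with this graph is the effective derivative $F'_{ef}(0)$. An $lC_0$-semigroup on $X$ is a function $T\in\mathcal E_X$ with $T(0)=I$ and $T(l+m)=T(l)T(m)$ for all $l,m\ge0$ such that $t\mapsto T(t)f$ is continuous on $[0,\infty)$ for every $f\in X$. Its generator is the operator $Zf=\lim_{h\downarrow0}h^{-1}(T(h)f-f)$, whose domain $\mathcal D(Z)$ consists of all $f$ for which the limit exists; one writes $T(t)=\exp(tZ)$. A set $\mathcal D\subset\mathcal D(Z)$ is a core of $Z$ if the closure of $\{(f,Zf):f\in\mathcal D\}$ in $X\times X$ is the graph of $Z$. **Theorem.** Let $Z$ be the generator of an $lC_0$-semigroup on $X$, let $\mathcal D$ be a core of $Z$, and let $F\in\mathcal F_X$ satisfy $f\in\mathcal D(F'_{ef}(0))$ and $F'_{ef}(0)f=Zf$ for every $f\in\mathcal D$. Then for every $f\in X$ and every $t_0>0$, $$F(t/n)^nf\longrightarrow\exp(tZ)f\qquad(n\to\infty)$$ uniformly with respect to $t\in[0,t_0]$. -/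

import Mathlib

open Filter Topology Set
open scoped NNReal

namespace LocallyConvexChernoff

/-- Sequential completeness: every Cauchy sequence converges. -/
def SeqComplete (X : Type*) [UniformSpace X] : Prop :=
  ∀ u : ℕ → X, CauchySeq u → ∃ x : X, Tendsto u atTop (𝓝 x)

section Equicontinuity

variable {𝕜 X Ω : Type*} [RCLike 𝕜] [AddCommGroup X] [Module 𝕜 X] [TopologicalSpace X]

/-- Equicontinuity of a set of operators, in terms of the seminorms `p α`, `α ∈ Ω`, that generate
the topology: every `p α (G x)`, `G ∈ 𝒢`, is bounded by one finite positive combination of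
seminorms of `x`. -/
def IsEquicontinuousFamily (p : SeminormFamily 𝕜 X Ω) (𝒢 : Set (X →L[𝕜] X)) : Prop :=
  ∀ α : Ω, ∃ (s : Finset Ω) (b : Ω → ℝ), (∀ i ∈ s, 0 < b i) ∧
    ∀ G ∈ 𝒢, ∀ x : X, p α (G x) ≤ ∑ i ∈ s, b i * p i x

/-- The family `{F(d/n)^m : m d / n ≤ s, n, m ∈ {1, 2, …}, d ≥ 0}`. -/
def powerFamily (F : ℝ≥0 → X →L[𝕜] X) (s : ℝ≥0) : Set (X →L[𝕜] X) :=
  {G | ∃ (n m : ℕ) (d : ℝ≥0), 0 < n ∧ 0 < m ∧ (m : ℝ≥0) * d / n ≤ s ∧ G = F (d / n) ^ m}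

/-- The class `𝓔_X`: `F(0) = I` and, for every `s ≥ 0`, the power family of `F` up to `s` is
equicontinuous. -/
structure MemE (p : SeminormFamily 𝕜 X Ω) (F : ℝ≥0 → X →L[𝕜] X) : Prop where
  map_zero : F 0 = 1
  equicontinuous : ∀ s : ℝ≥0, IsEquicontinuousFamily p (powerFamily F s)

/-- `lC₀`-semigroups: strongly continuous, locally equicontinuous one-parameter semigroups. -/
structure IsLC0Semigroup (p : SeminormFamily 𝕜 X Ω) (T : ℝ≥0 → X →L[𝕜] X) : Prop where
  map_zero : T 0 = 1
  map_add : ∀ l m : ℝ≥0, T (l + m) = T l * T m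
  continuous : ∀ x : X, Continuous fun t : ℝ≥0 => T t x
  memE : MemE p T

end Equicontinuity

section Derivatives

variable {𝕜 X : Type*} [RCLike 𝕜] [AddCommGroup X] [Module 𝕜 X] [TopologicalSpace X]
  [IsTopologicalAddGroup X] [ContinuousSMul 𝕜 X]

/-- The graph of the strong derivative of `F` at `0`: the pairs `(f, g)` with
`g = lim_{h → 0} h⁻¹ (F(h) f - F(0) f)`. -/
def strongDerivGraph (F : ℝ≥0 → X →L[𝕜] X) : Submodule 𝕜 (X × X) where
  carrier := {q | Tendsto (fun h : ℝ≥0 => ((h : ℝ) : 𝕜)⁻¹ • (F h q.1 - F 0 q.1))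
    (𝓝[>] 0) (𝓝 q.2)}
  zero_mem' := by
    simpa using (tendsto_const_nhds : Tendsto (fun _ : ℝ≥0 => (0 : X)) (𝓝[>] 0) (𝓝 0))
  add_mem' := by
    intro a b ha hb
    refine (Tendsto.add ha hb).congr fun h => ?_
    simp only [Prod.fst_add, _root_.map_add]
    rw [← smul_add]
    congr 1
    abel
  smul_mem' := by
    intro c a ha
    refine (Tendsto.const_smul ha c).congr fun h => ?_
    simp only [Prod.smul_fst, map_smul, smul_sub, smul_comm c]

/-- The strong derivative `F'(0)` at `0`, with domain the set of all `f` for which the limit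
exists. -/
noncomputable def strongDeriv (F : ℝ≥0 → X →L[𝕜] X) : X →ₗ.[𝕜] X :=
  (strongDerivGraph F).toLinearPMap

theorem mem_graph_strongDeriv [T2Space X] (F : ℝ≥0 → X →L[𝕜] X) (q : X × X) :
    q ∈ (strongDeriv F).graph ↔
      Tendsto (fun h : ℝ≥0 => ((h : ℝ) : 𝕜)⁻¹ • (F h q.1 - F 0 q.1)) (𝓝[>] 0) (𝓝 q.2) := by
  unfold strongDeriv
  rw [Submodule.toLinearPMap_graph_eq]
  · rfl
  · rintro ⟨x, y⟩ hx hx0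
    have hx0' : x = 0 := hx0
    subst hx0'
    have h : Tendsto (fun h : ℝ≥0 => ((h : ℝ) : 𝕜)⁻¹ • (F h (0 : X) - F 0 (0 : X)))
      (𝓝[>] 0) (𝓝 y) := hx
    simp only [map_zero, sub_zero, smul_zero] at h
    exact (tendsto_nhds_unique h tendsto_const_nhds)

/-- The many-valued effective derivative `F'_mef(0)`, as a linear relation: `g ∈ F'_mef(0) f` if
and only if there are `f_h`, `h ≥ 0`, with `f_h → f` and `h⁻¹ (F(h) - F(0)) f_h → g` as
`h → 0`. -/
def mefDeriv (F : ℝ≥0 → X →L[𝕜] X) : Submodule 𝕜 (X × X) where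
  carrier := {q | ∃ φ : ℝ≥0 → X, Tendsto φ (𝓝[>] 0) (𝓝 q.1) ∧
    Tendsto (fun h : ℝ≥0 => ((h : ℝ) : 𝕜)⁻¹ • (F h - F 0) (φ h)) (𝓝[>] 0) (𝓝 q.2)}
  zero_mem' := ⟨fun _ => 0, tendsto_const_nhds, by
    simpa using (tendsto_const_nhds : Tendsto (fun _ : ℝ≥0 => (0 : X)) (𝓝[>] 0) (𝓝 0))⟩
  add_mem' := by
    rintro a b ⟨φ, hφ, hφ'⟩ ⟨ψ, hψ, hψ'⟩
    refine ⟨fun h => φ h + ψ h, hφ.add hψ, (hφ'.add hψ').congr fun h => ?_⟩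
    rw [_root_.map_add, smul_add]
  smul_mem' := by
    rintro c a ⟨φ, hφ, hφ'⟩
    refine ⟨fun h => c • φ h, hφ.const_smul c, (hφ'.const_smul c).congr fun h => ?_⟩
    rw [map_smul, smul_comm]

/-- The domain of the (many-valued) effective derivative. -/
def mefDomain (F : ℝ≥0 → X →L[𝕜] X) : Set X :=
  {f | ∃ g : X, (f, g) ∈ mefDeriv F}

/-- The effective derivative `F'_ef(0)`: the linear operator whose graph is `F'_mef(0)`. As usual,
this is meaningful when `F'_mef(0)` is single-valued. -/
noncomputable def effDeriv (F : ℝ≥0 → X →L[𝕜] X) : X →ₗ.[𝕜] X :=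
  (mefDeriv F).toLinearPMap

/-- The class `𝓕_X`: members of `𝓔_X` with densely defined effective derivative. -/
structure MemF {Ω : Type*} (p : SeminormFamily 𝕜 X Ω) (F : ℝ≥0 → X →L[𝕜] X) : Prop where
  memE : MemE p F
  dense_domain : Dense (mefDomain F)

/-- `Z` is the generator of the `lC₀`-semigroup `T`. -/
structure IsGenerator {Ω : Type*} (p : SeminormFamily 𝕜 X Ω) (T : ℝ≥0 → X →L[𝕜] X)
    (Z : X →ₗ.[𝕜] X) : Prop where
  semigroup : IsLC0Semigroup p T
  eq_strongDeriv : Z = strongDeriv T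

/-- A set `D` contained in the domain of `Z` is a core of `Z` if the closure of
`{(x, Z x) : x ∈ D}` is the graph of `Z`. -/
structure IsCore (Z : X →ₗ.[𝕜] X) (D : Set X) : Prop where
  subset_domain : D ⊆ (Z.domain : Set X)
  closure_eq : closure {q : X × X | ∃ x : Z.domain, (x : X) ∈ D ∧ q = ((x : X), Z x)} =
    (Z.graph : Set (X × X))

end Derivatives

end LocallyConvexChernoff

/-!
The proof estimates `F(h)^m x - T(m h) x` directly, by telescoping; no resolvents are used, since an
`lC₀`-semigroup need not have any. Write `A_h = h⁻¹ (F(h) - F(0))`.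

Since the domain of the effective derivative is dense, the discrete orbits `F(h)^i y` are
equicontinuous at time zero (`MemF.short_time`), which makes the effective derivative single-valued
(`MemF.mefDeriv_singleValued`). Hence `(f, Z f)` belongs to the relation `mefDeriv F` for `f` in the
core, and the graph of `Z` lies in its closure. Closedness of the relation, for which a diagonal
argument would want `X` metrizable, is not needed: the estimates concern one seminorm and one
precision at a time.

Let `x ∈ D(Z)`. The pairs `(T(s) x, T(s) Z x)`, with `s` in a bounded interval, form a compact
subset of the graph of `Z`. So for all small `h` (`eventually_exists_approx`) there are vectors `ψ k` with
`ψ k ≈ T(k h) x` and `A_h (ψ k) ≈ T(k h) Z x`. Averaging them over `M` consecutive indices, with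
`M h ≈ τ`, gives vectors `v k` with the same properties whose increments are in addition under
control: `h⁻¹ (v (k + 1) - v k) = (M h)⁻¹ (ψ (k + M) - ψ k)`, which is close to `T(k h) Z x` by the
mean value inequality `IsLC0Semigroup.slope_sub_le`, provided the precision of the approximation is
small compared with `τ`. Thus `F(h) (v k) - v (k + 1)` is small compared with `h`, and
`F(h)^m (v 0) ≈ v m` by equicontinuity of the powers (`pow_apply_sub_le`).

The passage to arbitrary `f` needs the density of `D(Z)` (`IsLC0Semigroup.dense_domain`). This is
where sequential completeness enters: `D(Z)` contains the means `δ⁻¹ ∫₀^δ T(s) f ds`, obtained as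
limits of dyadic Riemann means.
-/

namespace LocallyConvexChernoff

/-! ### Continuous seminorms and averages -/

section Seminorms

variable {𝕜 X Ω : Type*} [RCLike 𝕜] [AddCommGroup X] [Module 𝕜 X]

theorem norm_coe_nnreal (h : ℝ≥0) : ‖((h : ℝ) : 𝕜)‖ = h := by
  rw [RCLike.norm_ofReal, NNReal.abs_eq]

theorem seminorm_sum_le (q : Seminorm 𝕜 X) {g : ℕ → X} {m : ℕ} {c : ℝ}
    (hg : ∀ i < m, q (g i) ≤ c) : q (∑ i ∈ Finset.range m, g i) ≤ m * c := by
  refine (Finset.le_sum_of_subadditive q (map_zero q).le (map_add_le_add q) _ g).trans ?_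
  refine (Finset.sum_le_card_nsmul _ _ c fun i hi => hg i (Finset.mem_range.1 hi)).trans ?_
  simp

theorem seminorm_avg_sub_le (q : Seminorm 𝕜 X) {g : ℕ → X} {m : ℕ} (hm : 0 < m) {c : ℝ} {y : X}
    (hg : ∀ i < m, q (g i - y) ≤ c) :
    q ((m : 𝕜)⁻¹ • ∑ i ∈ Finset.range m, g i - y) ≤ c := by
  have hm' : (m : 𝕜) ≠ 0 := by exact_mod_cast hm.ne'
  have hm'' : (0 : ℝ) < m := by exact_mod_cast hm
  have h1 : (m : 𝕜)⁻¹ • ∑ i ∈ Finset.range m, g i - y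
      = (m : 𝕜)⁻¹ • ∑ i ∈ Finset.range m, (g i - y) := by
    rw [Finset.sum_sub_distrib, smul_sub, Finset.sum_const, Finset.card_range,
      ← Nat.cast_smul_eq_nsmul 𝕜, inv_smul_smul₀ hm']
  rw [h1, map_smul_eq_mul, norm_inv, RCLike.norm_natCast, inv_mul_le_iff₀ hm'']
  exact seminorm_sum_le q hg

variable [TopologicalSpace X]

theorem continuous_finset_sup {p : SeminormFamily 𝕜 X Ω} (hp : WithSeminorms p) (s : Finset Ω) :
    Continuous (s.sup p : Seminorm 𝕜 X) := by
  have := hp.topologicalAddGroup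
  have h : Continuous (∑ i ∈ s, p i : Seminorm 𝕜 X) := by
    have : ((∑ i ∈ s, p i : Seminorm 𝕜 X) : X → ℝ) = fun x => ∑ i ∈ s, p i x := by
      ext x
      rw [_root_.sum_apply]
    rw [this]
    exact continuous_finsetSum _ fun i _ => hp.continuous_seminorm i
  exact Seminorm.continuous_of_le h (Seminorm.finset_sup_le_sum p s)

theorem eventually_seminorm_sub_lt [IsTopologicalAddGroup X] {ι : Type*} {l : Filter ι}
    {u : ι → X} {y : X}
    (hu : Tendsto u l (𝓝 y)) {q : Seminorm 𝕜 X} (hq : Continuous q) {ε : ℝ} (hε : 0 < ε) :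
    ∀ᶠ i in l, q (u i - y) < ε := by
  have h : Tendsto (fun i => q (u i - y)) l (𝓝 0) := by
    have := (hq.tendsto (y - y)).comp (hu.sub_const y)
    simpa [Function.comp_def] using this
  exact h.eventually_lt_const hε

theorem exists_seminorm_sub_lt_of_mem_closure [IsTopologicalAddGroup X] {S : Set X} {y : X}
    (hy : y ∈ closure S) {q : Seminorm 𝕜 X} (hq : Continuous q) {ε : ℝ} (hε : 0 < ε) :
    ∃ x ∈ S, q (x - y) < ε := by
  obtain ⟨x, hx, hxS⟩ := mem_closure_iff_nhds.1 hy _ (eventually_seminorm_sub_lt tendsto_id hq hε)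
  exact ⟨x, hxS, hx⟩

theorem eq_zero_of_forall_seminorm_le [T2Space X] {p : SeminormFamily 𝕜 X Ω}
    (hp : WithSeminorms p) {x : X} (h : ∀ i, ∀ ε : ℝ, 0 < ε → p i x ≤ ε) : x = 0 := by
  by_contra hx
  obtain ⟨i, hi⟩ := hp.separating_of_T1 x hx
  exact hi (le_antisymm (le_of_forall_pos_le_add fun ε hε => by simpa using h i ε hε)
    (apply_nonneg _ _))

/-- Equicontinuity of the powers of `F` up to time `s`, in terms of arbitrary continuous
seminorms. The power `m = 0` is included, so that in particular `q ≤ q'`. -/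
theorem MemE.exists_bound {p : SeminormFamily 𝕜 X Ω} (hp : WithSeminorms p)
    {F : ℝ≥0 → X →L[𝕜] X} (hF : MemE p F) {q : Seminorm 𝕜 X} (hq : Continuous q) (s : ℝ≥0) :
    ∃ q' : Seminorm 𝕜 X, Continuous q' ∧
      ∀ (h : ℝ≥0) (m : ℕ), m * h ≤ s → ∀ x, q ((F h ^ m) x) ≤ q' x := by
  have := hp.topologicalAddGroup
  obtain ⟨t, C, -, hqC⟩ := Seminorm.bound_of_continuous hp q hq
  choose u b hb hub using hF.equicontinuous s
  have hmem : ∀ (h : ℝ≥0) (m : ℕ), m * h ≤ s → F h ^ m ∈ powerFamily F s := by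
    intro h m hm
    rcases Nat.eq_zero_or_pos m with rfl | hm0
    · exact ⟨1, 1, 0, one_pos, one_pos, by simp, by simp [hF.map_zero]⟩
    · exact ⟨1, m, h, one_pos, hm0, by simpa using hm, by simp⟩
  let q' : Seminorm 𝕜 X := C • ∑ α ∈ t, ∑ i ∈ u α, (b α i).toNNReal • p i
  have hq' : ∀ x, q' x = C * ∑ α ∈ t, ∑ i ∈ u α, b α i * p i x := by
    intro x
    simp only [q', _root_.smul_apply, _root_.sum_apply, NNReal.smul_def, smul_eq_mul]
    congr 1
    refine Finset.sum_congr rfl fun α _ => Finset.sum_congr rfl fun i hi => ?_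
    rw [Real.coe_toNNReal _ (hb α i hi).le]
  refine ⟨q', ?_, fun h m hm x => ?_⟩
  · have : (q' : X → ℝ) = fun x => C * ∑ α ∈ t, ∑ i ∈ u α, b α i * p i x := funext hq'
    rw [this]
    have hc := fun i => hp.continuous_seminorm i
    fun_prop
  · rw [hq']
    refine (hqC _).trans ?_
    rw [_root_.smul_apply, NNReal.smul_def, smul_eq_mul]
    refine mul_le_mul_of_nonneg_left ?_ C.2
    refine (Seminorm.finset_sup_le_sum p t _).trans ?_
    rw [_root_.sum_apply]
    exact Finset.sum_le_sum fun α _ => hub α _ (hmem h m hm) x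

/-- Telescoping: an approximate orbit `v` of an operator `R` stays close to the exact one. -/
theorem pow_apply_sub_le [IsTopologicalAddGroup X] {R : X →L[𝕜] X} {q q' : Seminorm 𝕜 X}
    {m : ℕ} {v : ℕ → X} {c : ℝ}
    (hb : ∀ j ≤ m, ∀ x, q ((R ^ j) x) ≤ q' x) (hr : ∀ k < m, q' (R (v k) - v (k + 1)) ≤ c) :
    q ((R ^ m) (v 0) - v m) ≤ m * c := by
  have key : ∀ n j, j + n ≤ m → q ((R ^ j) ((R ^ n) (v 0) - v n)) ≤ n * c := by
    intro n
    induction n with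
    | zero => intro j _; simp
    | succ n ih =>
      intro j hj
      have e : (R ^ j) ((R ^ (n + 1)) (v 0) - v (n + 1))
          = (R ^ (j + 1)) ((R ^ n) (v 0) - v n) + (R ^ j) (R (v n) - v (n + 1)) := by
        rw [pow_succ' R n, pow_succ R j]
        simp only [mul_apply_eq_comp, map_sub]
        abel
      rw [e]
      refine (map_add_le_add q _ _).trans ?_
      rw [Nat.cast_succ, add_mul, one_mul]
      exact add_le_add (ih (j + 1) (by omega))
        ((hb j (by omega) _).trans (hr n (by omega)))
  simpa using key m 0 (by omega)

end Seminorms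

theorem exists_seminorm_of_mem_uniformity {𝕜 X Ω : Type*} [RCLike 𝕜]
    [AddCommGroup X] [Module 𝕜 X] [UniformSpace X] [IsUniformAddGroup X]
    {p : SeminormFamily 𝕜 X Ω} (hp : WithSeminorms p) {V : Set (X × X)} (hV : V ∈ uniformity X) :
    ∃ q : Seminorm 𝕜 X, Continuous q ∧ ∃ r : ℝ, 0 < r ∧ ∀ x y, q (y - x) < r → (x, y) ∈ V := by
  rw [uniformity_eq_comap_nhds_zero] at hV
  obtain ⟨U, hU, hUV⟩ := hV
  obtain ⟨s, r, hr, hs⟩ := (hp.mem_nhds_iff 0 U).1 hU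
  refine ⟨s.sup p, continuous_finset_sup hp s, r, hr, fun x y hxy => hUV (hs ?_)⟩
  rwa [Seminorm.mem_ball_zero]

theorem tendsto_div_natCast_zero (δ : ℝ≥0) : Tendsto (fun n : ℕ => δ / n) atTop (𝓝 0) :=
  NNReal.tendsto_coe.1 (by simpa using tendsto_const_div_atTop_nhds_zero_nat (δ : ℝ))

/-- A time `τ ≥ h` is a multiple `M h` of the step size, up to a factor between `1` and `2`. -/
theorem exists_nat_mul_le {h τ : ℝ≥0} (h0 : 0 < h) (hτ : h ≤ τ) :
    ∃ M : ℕ, 0 < M ∧ M * h ≤ τ ∧ τ ≤ 2 * (M * h) := by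
  have h1 : 1 ≤ τ / h := (one_le_div h0).2 hτ
  have h2 : 0 < ⌊τ / h⌋₊ := Nat.floor_pos.2 h1
  have h3 : (⌊τ / h⌋₊ : ℝ≥0) * h ≤ τ := (le_div_iff₀ h0).1 (Nat.floor_le (by positivity))
  have h4 : τ < (⌊τ / h⌋₊ + 1 : ℝ≥0) * h := (div_lt_iff₀ h0).1 (Nat.lt_floor_add_one _)
  refine ⟨⌊τ / h⌋₊, h2, h3, h4.le.trans ?_⟩
  have h5 : (1 : ℝ≥0) ≤ ⌊τ / h⌋₊ := by exact_mod_cast h2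
  rw [← mul_assoc]
  gcongr
  rw [two_mul]
  gcongr

/-! ### Difference quotients -/

section DiffQuot

variable {𝕜 X Ω : Type*} [RCLike 𝕜] [AddCommGroup X] [Module 𝕜 X] [TopologicalSpace X]
  [IsTopologicalAddGroup X] [ContinuousSMul 𝕜 X]

/-- The difference quotient `h⁻¹ (F(h) - F(0))`; it is the zero operator for `h = 0`. -/
noncomputable def diffQuot (F : ℝ≥0 → X →L[𝕜] X) (h : ℝ≥0) : X →L[𝕜] X :=
  ((h : ℝ) : 𝕜)⁻¹ • (F h - F 0)

variable {F : ℝ≥0 → X →L[𝕜] X}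

theorem pow_apply_sub_eq_smul_sum (hF : F 0 = 1) {h : ℝ≥0} (h0 : h ≠ 0) (m : ℕ) (v : X) :
    (F h ^ m) v - v
      = ((h : ℝ) : 𝕜) • ∑ i ∈ Finset.range m, (F h ^ i) (diffQuot F h v) := by
  have h0' : ((h : ℝ) : 𝕜) ≠ 0 := by simpa using h0
  have key : F h ^ m - 1 = (∑ i ∈ Finset.range m, F h ^ i) * (F h - 1) :=
    (geom_sum_mul (F h) m).symm
  have := congrArg (fun G : X →L[𝕜] X => G v) key
  simp only [_root_.sub_apply, mul_apply_eq_comp, one_apply_eq_self,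
    _root_.sum_apply] at this
  rw [this, Finset.smul_sum]
  refine Finset.sum_congr rfl fun i _ => ?_
  rw [← map_smul, diffQuot, _root_.smul_apply, smul_inv_smul₀ h0', hF]
  rfl

/-- The slope of a discrete orbit over `m` steps is the average of its one-step slopes. -/
theorem slope_pow_eq_avg (hF : F 0 = 1) {h : ℝ≥0} (h0 : h ≠ 0) {m : ℕ} (v : X) :
    (((m * h : ℝ≥0) : ℝ) : 𝕜)⁻¹ • ((F h ^ m) v - v)
      = (m : 𝕜)⁻¹ • ∑ i ∈ Finset.range m, (F h ^ i) (diffQuot F h v) := by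
  have h0' : ((h : ℝ) : 𝕜) ≠ 0 := by simpa using h0
  rw [pow_apply_sub_eq_smul_sum hF h0, smul_smul]
  congr 1
  push_cast
  rw [mul_inv, mul_assoc, inv_mul_cancel₀ h0', mul_one]

end DiffQuot

/-! ### The effective derivative -/

section EffectiveDerivative

variable {𝕜 X Ω : Type*} [RCLike 𝕜] [AddCommGroup X] [Module 𝕜 X] [TopologicalSpace X]
  [IsTopologicalAddGroup X] [ContinuousSMul 𝕜 X] {p : SeminormFamily 𝕜 X Ω}
  {F : ℝ≥0 → X →L[𝕜] X}

theorem mem_mefDeriv_iff {a : X × X} : a ∈ mefDeriv F ↔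
    ∃ φ : ℝ≥0 → X, Tendsto φ (𝓝[>] 0) (𝓝 a.1) ∧
      Tendsto (fun h => diffQuot F h (φ h)) (𝓝[>] 0) (𝓝 a.2) :=
  Iff.rfl

/-- Powers of `F(h)` up to a short time `τ` move `y` only a little, uniformly in small `h`. This
is clear for `y` in the domain of the effective derivative, and carries over by density. -/
theorem MemF.short_time (hp : WithSeminorms p) (hF : MemF p F) {q : Seminorm 𝕜 X}
    (hq : Continuous q) (y : X) {ε : ℝ} (hε : 0 < ε) :
    ∃ τ : ℝ≥0, 0 < τ ∧ ∀ᶠ h in 𝓝[>] (0 : ℝ≥0), ∀ m : ℕ, m * h ≤ τ →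
      q ((F h ^ m) y - y) ≤ ε := by
  obtain ⟨q', hq', hb⟩ := hF.memE.exists_bound hp hq 1
  have hqq' : ∀ x, q x ≤ q' x := fun x => by simpa using hb 0 0 (by simp) x
  obtain ⟨x, ⟨z, hxz⟩, hxy⟩ :=
    exists_seminorm_sub_lt_of_mem_closure (hF.dense_domain y) hq' (by positivity : 0 < ε / 8)
  obtain ⟨φ, hφ, hφ'⟩ := mem_mefDeriv_iff.1 hxz
  have hC : 0 < q' z + 1 := by positivity
  refine ⟨min 1 (ε / (2 * (q' z + 1))).toNNReal, by positivity, ?_⟩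
  filter_upwards [eventually_seminorm_sub_lt hφ hq' (by positivity : 0 < ε / 8),
    eventually_seminorm_sub_lt hφ' hq' one_pos, self_mem_nhdsWithin] with h h1 h2 h0 m hm
  have hm1 : m * h ≤ 1 := hm.trans (min_le_left _ _)
  have hm2 : (m * h : ℝ) * (q' z + 1) ≤ ε / 2 := by
    have h3 : ((m * h : ℝ≥0) : ℝ) ≤ ((ε / (2 * (q' z + 1))).toNNReal : ℝ) :=
      NNReal.coe_le_coe.2 (hm.trans (min_le_right _ _))
    rw [Real.coe_toNNReal _ (by positivity)] at h3
    push_cast at h3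
    calc (m * h : ℝ) * (q' z + 1) ≤ ε / (2 * (q' z + 1)) * (q' z + 1) := by gcongr
      _ = ε / 2 := by field_simp
  have h4 : q' (φ h - y) ≤ ε / 4 := by
    have := map_add_le_add q' (φ h - x) (x - y)
    rw [sub_add_sub_cancel] at this
    linarith
  have h5 : q' (diffQuot F h (φ h)) ≤ q' z + 1 := by
    have := map_add_le_add q' (diffQuot F h (φ h) - z) z
    rw [sub_add_cancel] at this
    linarith
  have h6 : q ((F h ^ m) (φ h) - φ h) ≤ ε / 2 := by
    rw [pow_apply_sub_eq_smul_sum hF.memE.map_zero h0.ne', map_smul_eq_mul, norm_coe_nnreal]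
    have : q (∑ i ∈ Finset.range m, (F h ^ i) (diffQuot F h (φ h))) ≤ m * (q' z + 1) := by
      refine seminorm_sum_le q fun i hi => (hb h i ?_ _).trans h5
      refine le_trans ?_ hm1
      gcongr
    calc (h : ℝ) * q (∑ i ∈ Finset.range m, (F h ^ i) (diffQuot F h (φ h)))
        ≤ h * (m * (q' z + 1)) := by gcongr
      _ = (m * h : ℝ) * (q' z + 1) := by ring
      _ ≤ ε / 2 := hm2
  have h7 : (F h ^ m) y - y
      = ((F h ^ m) (y - φ h) + ((F h ^ m) (φ h) - φ h)) + (φ h - y) := by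
    rw [map_sub]
    abel
  have h8 := hb h m hm1 (y - φ h)
  rw [map_sub_rev q'] at h8
  rw [h7]
  have h9 := map_add_le_add q ((F h ^ m) (y - φ h) + ((F h ^ m) (φ h) - φ h)) (φ h - y)
  have h10 := map_add_le_add q ((F h ^ m) (y - φ h)) ((F h ^ m) (φ h) - φ h)
  have h11 := hqq' (φ h - y)
  linarith

/-- The effective derivative is single-valued. If `φ_h → 0` and `h⁻¹ (F(h) - F(0)) φ_h → g`, then
the mean of `F(h)^i g` over times `i h ≤ τ` tends to `0` with `h`, yet for small `τ` it is close
to `g`. -/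
theorem MemF.mefDeriv_singleValued [T2Space X] (hp : WithSeminorms p) (hF : MemF p F) :
    ∀ a ∈ mefDeriv F, a.1 = 0 → a.2 = 0 := by
  rintro ⟨f, g⟩ hfg hf
  simp only at hf
  subst hf
  obtain ⟨φ, hφ, hφ'⟩ := mem_mefDeriv_iff.1 hfg
  refine eq_zero_of_forall_seminorm_le hp fun α ε hε => ?_
  have hα := hp.continuous_seminorm α
  obtain ⟨τ, hτ, hst⟩ := hF.short_time hp hα g (by positivity : 0 < ε / 3)
  obtain ⟨q', hq', hb⟩ := hF.memE.exists_bound hp hα τ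
  have hqq' : ∀ x, p α x ≤ q' x := fun x => by simpa using hb 0 0 (by simp) x
  obtain ⟨h, hst, h1, h2, hh⟩ := (hst.and ((eventually_seminorm_sub_lt hφ hq'
    (by positivity : 0 < ε * τ / 12)).and ((eventually_seminorm_sub_lt hφ' hq'
    (by positivity : 0 < ε / 3)).and (Ioc_mem_nhdsGT hτ)))).exists
  obtain ⟨M, hM, hMτ, hτM⟩ := exists_nat_mul_le hh.1 hh.2
  have hMh : 0 < (M * h : ℝ) := by
    have := hh.1
    positivity
  rw [sub_zero] at h1
  -- The slope `(M h)⁻¹ (F(h)^M φ_h - φ_h)` is close to `g`, being the mean of the vectors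
  -- `F(h)^i (h⁻¹ (F(h) - F(0)) φ_h)`, and it is small because `φ_h` is.
  have h3 : p α ((((M * h : ℝ≥0) : ℝ) : 𝕜)⁻¹ • ((F h ^ M) (φ h) - φ h) - g) ≤ ε / 3 + ε / 3 := by
    rw [slope_pow_eq_avg hF.memE.map_zero hh.1.ne']
    refine seminorm_avg_sub_le _ hM fun i hi => ?_
    have hi' : i * h ≤ τ := le_trans (by gcongr) hMτ
    have e : (F h ^ i) (diffQuot F h (φ h)) - g
        = (F h ^ i) (diffQuot F h (φ h) - g) + ((F h ^ i) g - g) := by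
      rw [map_sub]
      abel
    rw [e]
    exact (map_add_le_add _ _ _).trans (add_le_add ((hb h i hi' _).trans h2.le) (hst i hi'))
  have h4 : p α ((((M * h : ℝ≥0) : ℝ) : 𝕜)⁻¹ • ((F h ^ M) (φ h) - φ h)) ≤ ε / 3 := by
    rw [map_smul_eq_mul, norm_inv, norm_coe_nnreal, inv_mul_le_iff₀ (by push_cast; exact hMh)]
    have h5 := map_sub_le_add (p α) ((F h ^ M) (φ h)) (φ h)
    have h6 := hb h M hMτ (φ h)
    have h7 := hqq' (φ h)
    have h8 : (τ : ℝ) ≤ 2 * (M * h) := by exact_mod_cast hτM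
    rw [NNReal.coe_mul, NNReal.coe_natCast]
    nlinarith
  have h5 := map_sub_le_add (p α) ((((M * h : ℝ≥0) : ℝ) : 𝕜)⁻¹ • ((F h ^ M) (φ h) - φ h))
    ((((M * h : ℝ≥0) : ℝ) : 𝕜)⁻¹ • ((F h ^ M) (φ h) - φ h) - g)
  rw [sub_sub_cancel] at h5
  linarith

/-- `effDeriv F` takes its values in the relation `mefDeriv F`. Single-valuedness is needed here:
without it `Submodule.toLinearPMap` is the zero map. -/
theorem MemF.mem_mefDeriv_of_effDeriv_eq [T2Space X] (hp : WithSeminorms p) (hF : MemF p F)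
    {x z : X} (hx : x ∈ (effDeriv F).domain) (hz : effDeriv F ⟨x, hx⟩ = z) :
    (x, z) ∈ mefDeriv F := by
  subst hz
  exact Submodule.mem_graph_toLinearPMap (hF.mefDeriv_singleValued hp) ⟨x, hx⟩

/-- Points of a compact subset of the closure of `mefDeriv F` can be approximated through the
difference quotients of `F` with a threshold on `h` that is uniform over the set. -/
theorem eventually_exists_approx {K : Set (X × X)} (hK : IsCompact K)
    (hKF : K ⊆ closure (mefDeriv F : Set (X × X))) {q : Seminorm 𝕜 X} (hq : Continuous q)
    {ε₁ ε₂ : ℝ} (h₁ : 0 < ε₁) (h₂ : 0 < ε₂) :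
    ∀ᶠ h in 𝓝[>] (0 : ℝ≥0), ∀ a ∈ K, ∃ ψ : X,
      q (ψ - a.1) ≤ ε₁ ∧ q (diffQuot F h ψ - a.2) ≤ ε₂ := by
  refine hK.induction_on (p := fun s => ∀ᶠ h in 𝓝[>] (0 : ℝ≥0), ∀ a ∈ s, ∃ ψ : X,
    q (ψ - a.1) ≤ ε₁ ∧ q (diffQuot F h ψ - a.2) ≤ ε₂) ?_ ?_ ?_ ?_
  · simp
  · intro s t hst ht
    exact ht.mono fun h H a ha => H a (hst ha)
  · intro s t hs ht
    filter_upwards [hs, ht] with h hs ht a ha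
    exact ha.elim (hs a) (ht a)
  · intro a ha
    have hev : ∀ᶠ b in 𝓝 a, q (b.1 - a.1) < ε₁ / 3 ∧ q (b.2 - a.2) < ε₂ / 3 :=
      (eventually_seminorm_sub_lt (continuous_fst.tendsto a) hq (by positivity)).and
        (eventually_seminorm_sub_lt (continuous_snd.tendsto a) hq (by positivity))
    refine ⟨_, mem_nhdsWithin_of_mem_nhds hev, ?_⟩
    obtain ⟨c, ⟨hc1, hc2⟩, hcF⟩ := mem_closure_iff_nhds.1 (hKF ha) _ hev
    obtain ⟨φ, hφ, hφ'⟩ := mem_mefDeriv_iff.1 hcF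
    filter_upwards [eventually_seminorm_sub_lt hφ hq (by positivity : 0 < ε₁ / 3),
      eventually_seminorm_sub_lt hφ' hq (by positivity : 0 < ε₂ / 3)] with h k1 k2 b hb
    have key : ∀ u v w r : X, q (u - r) ≤ q (u - v) + q (v - w) + q (r - w) := by
      intro u v w r
      have e : u - r = (u - v) + (v - w) - (r - w) := by abel
      rw [e]
      exact (map_sub_le_add q _ _).trans (by gcongr; exact map_add_le_add q _ _)
    refine ⟨φ h, ?_, ?_⟩
    · have := key (φ h) c.1 a.1 b.1
      linarith [hb.1]
    · have := key (diffQuot F h (φ h)) c.2 a.2 b.2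
      linarith [hb.2]

end EffectiveDerivative

/-! ### Semigroups and their generators -/

section Semigroup

variable {𝕜 X Ω : Type*} [RCLike 𝕜] [AddCommGroup X] [Module 𝕜 X] [TopologicalSpace X]
  {p : SeminormFamily 𝕜 X Ω} {T : ℝ≥0 → X →L[𝕜] X}

theorem IsLC0Semigroup.pow_eq (hT : IsLC0Semigroup p T) (h : ℝ≥0) (m : ℕ) :
    T h ^ m = T (m * h) := by
  induction m with
  | zero => simp [hT.map_zero]
  | succ m ih => rw [pow_succ, ih, ← hT.map_add, Nat.cast_succ, add_mul, one_mul]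

theorem IsLC0Semigroup.exists_bound (hp : WithSeminorms p) (hT : IsLC0Semigroup p T)
    {q : Seminorm 𝕜 X} (hq : Continuous q) (s : ℝ≥0) :
    ∃ q' : Seminorm 𝕜 X, Continuous q' ∧ ∀ t ≤ s, ∀ x, q (T t x) ≤ q' x := by
  obtain ⟨q', hq', hb⟩ := hT.memE.exists_bound hp hq s
  exact ⟨q', hq', fun t ht x => by simpa using hb t 1 (by simpa using ht) x⟩

variable [IsTopologicalAddGroup X]

theorem IsLC0Semigroup.exists_forall_le_sub_le (hT : IsLC0Semigroup p T) {q : Seminorm 𝕜 X}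
    (hq : Continuous q) (x : X) {ε : ℝ} (hε : 0 < ε) :
    ∃ δ : ℝ≥0, 0 < δ ∧ ∀ r ≤ δ, q (T r x - x) ≤ ε := by
  have h0 : Tendsto (fun t => T t x) (𝓝 0) (𝓝 x) := by
    have := (hT.continuous x).tendsto 0
    simpa [hT.map_zero] using this
  obtain ⟨δ, hδ, H⟩ := NNReal.nhds_zero_basis.eventually_iff.1
    (eventually_seminorm_sub_lt h0 hq hε)
  exact ⟨δ / 2, by positivity, fun r hr => (H (hr.trans_lt (NNReal.half_lt_self hδ.ne'))).le⟩

/-- One-sided uniform continuity of the orbit of `x` at times `s ≤ S`. -/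
theorem IsLC0Semigroup.exists_forall_add_sub_le (hp : WithSeminorms p) (hT : IsLC0Semigroup p T)
    {q : Seminorm 𝕜 X} (hq : Continuous q) (S : ℝ≥0) (x : X) {ε : ℝ} (hε : 0 < ε) :
    ∃ δ : ℝ≥0, 0 < δ ∧ ∀ s ≤ S, ∀ r ≤ δ, q (T (s + r) x - T s x) ≤ ε := by
  obtain ⟨q', hq', hb⟩ := hT.exists_bound hp hq S
  obtain ⟨δ, hδ, H⟩ := hT.exists_forall_le_sub_le hq' x hε
  refine ⟨δ, hδ, fun s hs r hr => ?_⟩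
  have e : T (s + r) x - T s x = T s (T r x - x) := by
    rw [hT.map_add, mul_apply_eq_comp, map_sub]
  rw [e]
  exact (hb s hs _).trans (H r hr)

theorem IsLC0Semigroup.tendsto_apply (hp : WithSeminorms p) (hT : IsLC0Semigroup p T)
    {ι : Type*} {l : Filter ι} {s : ι → ℝ≥0} {t : ℝ≥0} {x : ι → X} {y : X}
    (hs : Tendsto s l (𝓝 t)) (hst : ∀ i, s i ≤ t) (hx : Tendsto x l (𝓝 y)) :
    Tendsto (fun i => T (s i) (x i)) l (𝓝 (T t y)) := by
  refine (hp.tendsto_nhds _ _).2 fun α ε hε => ?_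
  obtain ⟨q', hq', hb⟩ := hT.exists_bound hp (hp.continuous_seminorm α) t
  filter_upwards [eventually_seminorm_sub_lt hx hq' (half_pos hε), eventually_seminorm_sub_lt
    (((hT.continuous y).tendsto t).comp hs) (hp.continuous_seminorm α) (half_pos hε)]
    with i h1 h2
  have e : T (s i) (x i) - T t y = T (s i) (x i - y) + (T (s i) y - T t y) := by
    rw [map_sub]
    abel
  rw [e]
  refine (map_add_le_add _ _ _).trans_lt ?_
  have := hb (s i) (hst i) (x i - y)
  simp only [Function.comp] at h2
  linarith

variable [ContinuousSMul 𝕜 X]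

theorem mem_strongDerivGraph_iff {F : ℝ≥0 → X →L[𝕜] X} {a : X × X} :
    a ∈ strongDerivGraph F ↔ Tendsto (fun h => diffQuot F h a.1) (𝓝[>] 0) (𝓝 a.2) :=
  Iff.rfl

theorem IsLC0Semigroup.apply_mem_strongDerivGraph (hT : IsLC0Semigroup p T) {x z : X}
    (hxz : (x, z) ∈ strongDerivGraph T) (s : ℝ≥0) : (T s x, T s z) ∈ strongDerivGraph T := by
  rw [mem_strongDerivGraph_iff] at hxz ⊢
  refine (((T s).continuous.tendsto z).comp hxz).congr fun h => ?_
  have hcomm : ∀ t, T s (T t x) = T t (T s x) := fun t => by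
    rw [← mul_apply_eq_comp, ← mul_apply_eq_comp, ← hT.map_add, ← hT.map_add, add_comm]
  simp only [Function.comp, diffQuot, _root_.smul_apply, _root_.sub_apply, map_smul, map_sub,
    hcomm]

/-- A mean value inequality: difference quotients of the orbit of `x ∈ D(Z)` are as close to `y`
as the values `T(s) Z x` of its derivative. -/
theorem IsLC0Semigroup.slope_sub_le (hp : WithSeminorms p) (hT : IsLC0Semigroup p T) {x z : X}
    (hxz : (x, z) ∈ strongDerivGraph T) {q : Seminorm 𝕜 X} (hq : Continuous q) {y : X}
    {δ : ℝ≥0} (hδ : 0 < δ) {c : ℝ} (hc : ∀ s ≤ δ, q (T s z - y) ≤ c) :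
    q (((δ : ℝ) : 𝕜)⁻¹ • (T δ x - x) - y) ≤ c := by
  refine le_of_forall_pos_le_add fun η hη => ?_
  obtain ⟨q', hq', hb⟩ := hT.exists_bound hp hq δ
  have hlim : Tendsto (fun n : ℕ => δ / n) atTop (𝓝[>] 0) := by
    refine tendsto_nhdsWithin_iff.2 ⟨tendsto_div_natCast_zero δ, ?_⟩
    filter_upwards [eventually_gt_atTop 0] with n hn
    exact div_pos hδ (by exact_mod_cast hn)
  obtain ⟨N, hN, hN0⟩ := ((hlim.eventually (eventually_seminorm_sub_lt
    (mem_strongDerivGraph_iff.1 hxz) hq' hη)).and (eventually_gt_atTop 0)).exists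
  have hN0' : (0 : ℝ≥0) < N := by exact_mod_cast hN0
  have hNδ : N * (δ / N) = δ := mul_div_cancel₀ δ hN0'.ne'
  have key := slope_pow_eq_avg hT.map_zero (div_pos hδ hN0').ne' (m := N) x
  rw [hT.pow_eq, hNδ] at key
  rw [key]
  refine seminorm_avg_sub_le q hN0 fun i hi => ?_
  have hi' : i * (δ / N) ≤ δ := le_trans (by gcongr) hNδ.le
  rw [hT.pow_eq]
  have e : T (i * (δ / N)) (diffQuot T (δ / N) x) - y
      = T (i * (δ / N)) (diffQuot T (δ / N) x - z) + (T (i * (δ / N)) z - y) := by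
    rw [map_sub]
    abel
  rw [e, add_comm]
  exact (map_add_le_add _ _ _).trans (add_le_add (hc _ hi') ((hb _ hi' _).trans hN.le))

end Semigroup

/-! ### Riemann means of orbits -/

section RiemannMean

variable {𝕜 X Ω : Type*} [RCLike 𝕜] [AddCommGroup X] [Module 𝕜 X] [TopologicalSpace X]
  {p : SeminormFamily 𝕜 X Ω} {T : ℝ≥0 → X →L[𝕜] X}

/-- The Riemann mean of `s ↦ T(s) f` over `[0, δ]`, for the subdivision into `n` equal parts. -/
noncomputable def riemannMean (T : ℝ≥0 → X →L[𝕜] X) (δ : ℝ≥0) (f : X) (n : ℕ) : X :=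
  (n : 𝕜)⁻¹ • ∑ i ∈ Finset.range n, T (i * (δ / n)) f

theorem riemannMean_sub_le (q : Seminorm 𝕜 X) {δ : ℝ≥0} {f y : X} {n : ℕ} (hn : 0 < n) {c : ℝ}
    (hc : ∀ s ≤ δ, q (T s f - y) ≤ c) : q (riemannMean T δ f n - y) ≤ c := by
  refine seminorm_avg_sub_le q hn fun i hi => hc _ ?_
  have hn' : (n : ℝ≥0) ≠ 0 := by exact_mod_cast hn.ne'
  calc i * (δ / n) ≤ n * (δ / n) := by gcongr
    _ = δ := mul_div_cancel₀ δ hn'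

/-- Refining a subdivision into `a` parts to one into `a * b` parts averages each value of the
orbit over a subinterval. -/
theorem IsLC0Semigroup.riemannMean_mul (hT : IsLC0Semigroup p T) (δ : ℝ≥0) (f : X) {a b : ℕ}
    (hb : 0 < b) : riemannMean T δ f (a * b)
      = (a : 𝕜)⁻¹ • ∑ i ∈ Finset.range a, T (i * (δ / a)) (riemannMean T (δ / a) f b) := by
  have hsum : ∀ c : ℕ, ∑ k ∈ Finset.range (c * b), T (k * (δ / (a * b : ℕ))) f
      = ∑ i ∈ Finset.range c, ∑ j ∈ Finset.range b, T (i * (δ / a)) (T (j * (δ / a / b)) f) := by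
    intro c
    induction c with
    | zero => simp
    | succ c ih =>
      rw [add_mul, one_mul, Finset.sum_range_add, ih, Finset.sum_range_succ]
      congr 1
      refine Finset.sum_congr rfl fun j _ => ?_
      rw [← mul_apply_eq_comp, ← hT.map_add]
      congr 2
      have : (b : ℝ≥0) ≠ 0 := by exact_mod_cast hb.ne'
      push_cast
      rw [add_mul, div_div, mul_div_assoc', mul_div_assoc', mul_assoc, mul_comm (b : ℝ≥0) δ,
        ← mul_assoc, mul_div_mul_right _ _ this, mul_div_assoc]
  simp only [riemannMean, map_smul, map_sum, hsum, ← Finset.smul_sum]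
  rw [smul_smul, Nat.cast_mul, mul_inv]

variable [IsTopologicalAddGroup X]

/-- Difference quotients of a Riemann mean over multiples of the step size telescope to averages
of `T(s)` applied to `δ⁻¹ (T(δ) f - f)`. -/
theorem IsLC0Semigroup.slope_riemannMean (hT : IsLC0Semigroup p T) (δ : ℝ≥0)
    (f : X) {n m : ℕ} (hn : 0 < n) :
    (((m * (δ / n) : ℝ≥0) : ℝ) : 𝕜)⁻¹ •
        (T (m * (δ / n)) (riemannMean T δ f n) - riemannMean T δ f n)
      = (m : 𝕜)⁻¹ • ∑ i ∈ Finset.range m, T (i * (δ / n)) (((δ : ℝ) : 𝕜)⁻¹ • (T δ f - f)) := by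
  have hn' : (n : ℝ≥0) ≠ 0 := by exact_mod_cast hn.ne'
  have hn'' : (n : 𝕜) ≠ 0 := by exact_mod_cast hn.ne'
  set R := T (δ / n)
  have hpow : ∀ k : ℕ, T (k * (δ / n)) = R ^ k := fun k => (hT.pow_eq _ k).symm
  have hRn : T δ = R ^ n := by rw [← hpow, mul_div_cancel₀ δ hn']
  have hcomm : (R ^ m - 1) * ∑ i ∈ Finset.range n, R ^ i
      = (∑ i ∈ Finset.range m, R ^ i) * (R ^ n - 1) := by
    rw [← geom_sum_mul R m, mul_assoc, mul_geom_sum]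
  have happ := congrArg (fun G : X →L[𝕜] X => G f) hcomm
  simp only [_root_.sub_apply, mul_apply_eq_comp, one_apply_eq_self, _root_.sum_apply] at happ
  simp only [riemannMean, hpow, hRn, map_smul, ← smul_sub, ← Finset.smul_sum]
  rw [happ, smul_smul, smul_smul]
  congr 1
  push_cast
  rw [mul_inv, inv_div]
  field_simp

end RiemannMean

/-! ### Density of the domain of the generator -/

section GeneratorDomain

variable {𝕜 X Ω : Type*} [RCLike 𝕜] [AddCommGroup X] [Module 𝕜 X] [UniformSpace X]
  [IsUniformAddGroup X] {p : SeminormFamily 𝕜 X Ω} {T : ℝ≥0 → X →L[𝕜] X}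

/-- Sequential completeness provides the integral mean of an orbit, as a limit of Riemann means;
dyadic subdivisions refine one another. -/
theorem IsLC0Semigroup.exists_tendsto_riemannMean (hp : WithSeminorms p) (hX : SeqComplete X)
    (hT : IsLC0Semigroup p T) (δ : ℝ≥0) (f : X) :
    ∃ y, Tendsto (fun k : ℕ => riemannMean T δ f (2 ^ k)) atTop (𝓝 y) := by
  refine hX _ (cauchySeq_iff.2 fun V hV => ?_)
  obtain ⟨q, hq, r, hr, hqV⟩ := exists_seminorm_of_mem_uniformity hp hV
  obtain ⟨ρ, hρ, H⟩ := hT.exists_forall_add_sub_le hp hq δ f (by positivity : 0 < r / 3)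
  have hlim : Tendsto (fun k : ℕ => δ / ((2 ^ k : ℕ) : ℝ≥0)) atTop (𝓝 0) :=
    (tendsto_div_natCast_zero δ).comp (tendsto_pow_atTop_atTop_of_one_lt one_lt_two)
  obtain ⟨N, hN⟩ := (hlim.eventually (ge_mem_nhds hρ)).exists
  have key : ∀ k ≥ N, q (riemannMean T δ f (2 ^ k) - riemannMean T δ f (2 ^ N)) ≤ r / 3 := by
    intro k hk
    obtain ⟨j, rfl⟩ := Nat.exists_eq_add_of_le hk
    rw [pow_add, hT.riemannMean_mul δ f (by positivity)]
    conv in riemannMean T δ f (2 ^ N) => rw [riemannMean]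
    rw [← smul_sub, ← Finset.sum_sub_distrib]
    have := seminorm_avg_sub_le q (g := fun i => T (i * (δ / (2 ^ N : ℕ)))
      (riemannMean T (δ / (2 ^ N : ℕ)) f (2 ^ j)) - T (i * (δ / (2 ^ N : ℕ))) f)
      (by positivity : 0 < 2 ^ N) (c := r / 3) (y := 0) ?_
    · simpa only [sub_zero] using this
    intro i hi
    have hn' : ((2 ^ N : ℕ) : ℝ≥0) ≠ 0 := by positivity
    have hi' : i * (δ / (2 ^ N : ℕ)) ≤ δ := by
      calc i * (δ / (2 ^ N : ℕ)) ≤ (2 ^ N : ℕ) * (δ / (2 ^ N : ℕ)) := by gcongr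
        _ = δ := mul_div_cancel₀ δ hn'
    have hlin : T (i * (δ / (2 ^ N : ℕ))) (riemannMean T (δ / (2 ^ N : ℕ)) f (2 ^ j))
        = ((2 ^ j : ℕ) : 𝕜)⁻¹ • ∑ l ∈ Finset.range (2 ^ j),
          T (i * (δ / (2 ^ N : ℕ)) + l * (δ / (2 ^ N : ℕ) / (2 ^ j : ℕ))) f := by
      simp only [riemannMean, map_smul, map_sum, hT.map_add, mul_apply_eq_comp]
    rw [sub_zero, hlin]
    refine seminorm_avg_sub_le q (by positivity) fun l hl => H _ hi' _ (le_trans ?_ hN)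
    have hj' : ((2 ^ j : ℕ) : ℝ≥0) ≠ 0 := by positivity
    calc l * (δ / (2 ^ N : ℕ) / (2 ^ j : ℕ))
        ≤ (2 ^ j : ℕ) * (δ / (2 ^ N : ℕ) / (2 ^ j : ℕ)) := by gcongr
      _ = δ / (2 ^ N : ℕ) := mul_div_cancel₀ _ hj'
  refine ⟨N, fun k hk l hl => hqV _ _ ?_⟩
  have h1 := map_sub_le_add q (riemannMean T δ f (2 ^ l) - riemannMean T δ f (2 ^ N))
    (riemannMean T δ f (2 ^ k) - riemannMean T δ f (2 ^ N))
  rw [sub_sub_sub_cancel_right] at h1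
  linarith [key k hk, key l hl]

variable [ContinuousSMul 𝕜 X]

/-- The limit `y = δ⁻¹ ∫₀^δ T(s) f ds` of the Riemann means lies in the domain of the generator,
with `Z y = δ⁻¹ (T(δ) f - f)`. -/
theorem IsLC0Semigroup.mem_strongDerivGraph_of_tendsto_riemannMean (hp : WithSeminorms p)
    (hT : IsLC0Semigroup p T) {δ : ℝ≥0} (hδ : 0 < δ) {f y : X}
    (hy : Tendsto (fun k : ℕ => riemannMean T δ f (2 ^ k)) atTop (𝓝 y)) :
    (y, ((δ : ℝ) : 𝕜)⁻¹ • (T δ f - f)) ∈ strongDerivGraph T := by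
  rw [mem_strongDerivGraph_iff]
  set g := ((δ : ℝ) : 𝕜)⁻¹ • (T δ f - f) with hg
  refine (hp.tendsto_nhds _ _).2 fun α ε hε => ?_
  have hα := hp.continuous_seminorm α
  obtain ⟨ρ, hρ, H⟩ := hT.exists_forall_le_sub_le hα g (half_pos hε)
  filter_upwards [Ioc_mem_nhdsGT hρ] with h hh
  refine lt_of_le_of_lt ?_ (half_lt_self hε)
  -- Approximate `h` from below by a multiple `m k * η k` of the step `η k` of the subdivision.
  let η : ℕ → ℝ≥0 := fun k => δ / (2 ^ k : ℕ)
  have hη : ∀ k, 0 < η k := fun k => div_pos hδ (by positivity)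
  have hη0 : Tendsto η atTop (𝓝 0) :=
    (tendsto_div_natCast_zero δ).comp (tendsto_pow_atTop_atTop_of_one_lt one_lt_two)
  let m : ℕ → ℕ := fun k => ⌊h / η k⌋₊
  have hmh : ∀ k, m k * η k ≤ h := fun k =>
    (le_div_iff₀ (hη k)).1 (Nat.floor_le (by positivity))
  have hmη : ∀ k, h ≤ m k * η k + η k := fun k => by
    have := (div_lt_iff₀ (hη k)).1 (Nat.lt_floor_add_one (h / η k))
    rw [add_mul, one_mul] at this
    exact this.le
  have hlim : Tendsto (fun k => m k * η k) atTop (𝓝 h) := by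
    have h1 : Tendsto (fun k => h - η k) atTop (𝓝 h) := by
      simpa using tendsto_const_nhds.sub hη0
    exact tendsto_of_tendsto_of_tendsto_of_le_of_le h1 tendsto_const_nhds
      (fun k => tsub_le_iff_right.2 (hmη k)) hmh
  have hslope : Tendsto (fun k => (((m k * η k : ℝ≥0) : ℝ) : 𝕜)⁻¹ •
      (T (m k * η k) (riemannMean T δ f (2 ^ k)) - riemannMean T δ f (2 ^ k))) atTop
      (𝓝 (diffQuot T h y)) := by
    have h1 : Tendsto (fun k => (((m k * η k : ℝ≥0) : ℝ) : 𝕜)⁻¹) atTop (𝓝 ((h : ℝ) : 𝕜)⁻¹) := by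
      refine Tendsto.inv₀ ?_ (by simpa using hh.1.ne')
      exact (RCLike.continuous_ofReal.tendsto _).comp (NNReal.tendsto_coe.2 hlim)
    have h2 := h1.smul ((hT.tendsto_apply hp hlim hmh hy).sub hy)
    simpa only [diffQuot, _root_.smul_apply, _root_.sub_apply, hT.map_zero, one_apply_eq_self]
      using h2
  refine le_of_tendsto ((hα.tendsto _).comp (hslope.sub_const g)) ?_
  filter_upwards [hlim.eventually (lt_mem_nhds hh.1)] with k hk
  have hm0 : 0 < m k := Nat.pos_of_ne_zero fun h0 => by simp [h0] at hk
  simp only [Function.comp]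
  rw [hT.slope_riemannMean δ f (by positivity)]
  refine seminorm_avg_sub_le _ hm0 fun i hi => H _ (le_trans ?_ ((hmh k).trans hh.2))
  change i * η k ≤ m k * η k
  gcongr

/-- The generator of an `lC₀`-semigroup is densely defined. -/
theorem IsLC0Semigroup.dense_domain (hp : WithSeminorms p) (hX : SeqComplete X)
    (hT : IsLC0Semigroup p T) : Dense {x | ∃ z, (x, z) ∈ strongDerivGraph T} := by
  intro f
  refine mem_closure_iff_nhds.2 fun U hU => ?_
  obtain ⟨s, r, hr, hs⟩ := (hp.mem_nhds_iff f U).1 hU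
  have hq := continuous_finset_sup hp s
  obtain ⟨δ, hδ, H⟩ := hT.exists_forall_le_sub_le hq f (half_pos hr)
  obtain ⟨y, hy⟩ := hT.exists_tendsto_riemannMean hp hX δ f
  refine ⟨y, hs ?_, _, hT.mem_strongDerivGraph_of_tendsto_riemannMean hp hδ hy⟩
  rw [Seminorm.mem_ball]
  refine lt_of_le_of_lt ?_ (half_lt_self hr)
  exact le_of_tendsto ((hq.tendsto _).comp (hy.sub_const f)) (Eventually.of_forall fun k =>
    riemannMean_sub_le _ (by positivity) H)

end GeneratorDomain

/-! ### Convergence -/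

section Chernoff

variable {𝕜 X Ω : Type*} [RCLike 𝕜] [AddCommGroup X] [Module 𝕜 X] [TopologicalSpace X]
  [IsTopologicalAddGroup X] [ContinuousSMul 𝕜 X] {p : SeminormFamily 𝕜 X Ω}
  {T F : ℝ≥0 → X →L[𝕜] X}

/-- Convergence for `x` in the domain of the generator, uniformly over the grid times `m h ≤ S`.
The vectors `v k` form an approximate orbit of `F(h)` near `T(k h) x`: they are moving averages,
over a time window of length about `τ`, of vectors `ψ k` that approximate both `T(k h) x` and,
through the difference quotient of `F`, `T(k h) z`. -/
theorem eventually_pow_sub_le_of_mem_graph (hp : WithSeminorms p) (hT : IsLC0Semigroup p T)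
    (hF : MemE p F)
    (hTF : (strongDerivGraph T : Set (X × X)) ⊆ closure (mefDeriv F : Set (X × X)))
    {x z : X} (hxz : (x, z) ∈ strongDerivGraph T) {q : Seminorm 𝕜 X} (hq : Continuous q)
    (S : ℝ≥0) {ε : ℝ} (hε : 0 < ε) :
    ∀ᶠ h in 𝓝[>] (0 : ℝ≥0), ∀ m : ℕ, m * h ≤ S →
      q ((F h ^ m) x - T (m * h) x) ≤ 4 * S * ε + 4 * ε := by
  obtain ⟨q', hq', hb⟩ := hF.exists_bound hp hq S
  have hqq' : ∀ x, q x ≤ q' x := fun x => by simpa using hb 0 0 (by simp) x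
  obtain ⟨τ₁, hτ₁, H₁⟩ := hT.exists_forall_add_sub_le hp hq' S x hε
  obtain ⟨τ₂, hτ₂, H₂⟩ := hT.exists_forall_add_sub_le hp hq' S z hε
  -- `τ` is the time scale of averaging.
  obtain ⟨τ, hτ, hτ1, hτx, hτz⟩ : ∃ τ : ℝ≥0, 0 < τ ∧ τ ≤ 1 ∧
      (∀ s ≤ S, ∀ r ≤ τ, q' (T (s + r) x - T s x) ≤ ε) ∧
      (∀ s ≤ S, ∀ r ≤ τ, q' (T (s + r) z - T s z) ≤ ε) :=
    ⟨min 1 (min τ₁ τ₂), by positivity, min_le_left _ _,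
      fun s hs r hr => H₁ s hs r (hr.trans ((min_le_right _ _).trans (min_le_left _ _))),
      fun s hs r hr => H₂ s hs r (hr.trans ((min_le_right _ _).trans (min_le_right _ _)))⟩
  let K : Set (X × X) := (fun s => (T s x, T s z)) '' Icc 0 (S + 1)
  have hK : IsCompact K :=
    isCompact_Icc.image ((hT.continuous x).prodMk (hT.continuous z))
  have hKF : K ⊆ closure (mefDeriv F : Set (X × X)) := by
    rintro _ ⟨s, -, rfl⟩
    exact hTF (hT.apply_mem_strongDerivGraph hxz s)
  -- The precision `ε * τ / 4` is finer than `τ`, because it gets divided by `M * h ≥ τ / 2`.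
  filter_upwards [eventually_exists_approx hK hKF hq' (by positivity : 0 < ε * τ / 4) hε,
    Ioc_mem_nhdsGT hτ] with h happrox hh m hm
  obtain ⟨M, hM, hMτ, hτM⟩ := exists_nat_mul_le hh.1 hh.2
  have happrox' : ∀ k : ℕ, ∃ ψ : X, k * h ≤ S + 1 → q' (ψ - T (k * h) x) ≤ ε * τ / 4 ∧
      q' (diffQuot F h ψ - T (k * h) z) ≤ ε := by
    intro k
    by_cases hk : k * h ≤ S + 1
    · obtain ⟨ψ, hψ⟩ := happrox _ ⟨k * h, ⟨zero_le, hk⟩, rfl⟩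
      exact ⟨ψ, fun _ => hψ⟩
    · exact ⟨0, fun h => absurd h hk⟩
  choose ψ hψ using happrox'
  let v : ℕ → X := fun k => (M : 𝕜)⁻¹ • ∑ i ∈ Finset.range M, ψ (k + i)
  have hMh0 : 0 < M * h := mul_pos (by exact_mod_cast hM) hh.1
  have hMhτ : (τ : ℝ) ≤ 2 * ((M * h : ℝ≥0) : ℝ) := by exact_mod_cast hτM
  have hτ1' : (τ : ℝ) ≤ 1 := by exact_mod_cast hτ1
  have htime : ∀ k : ℕ, k * h ≤ S → ∀ i ≤ M, ((k + i : ℕ) : ℝ≥0) * h ≤ S + 1 ∧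
      ((k + i : ℕ) : ℝ≥0) * h = k * h + i * h ∧ i * h ≤ τ := by
    intro k hk i hi
    have h1 : i * h ≤ τ := le_trans (by gcongr) hMτ
    have h2 : ((k + i : ℕ) : ℝ≥0) * h = k * h + i * h := by
      push_cast
      ring
    exact ⟨h2 ▸ add_le_add hk (h1.trans hτ1), h2, h1⟩
  have hv : ∀ k : ℕ, k * h ≤ S → q' (v k - T (k * h) x) ≤ 2 * ε := by
    intro k hk
    refine seminorm_avg_sub_le q' hM fun i hi => ?_
    obtain ⟨h1, h2, h3⟩ := htime k hk i hi.le
    have h4 := (hψ (k + i) h1).1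
    have h5 := hτx _ hk _ h3
    rw [← h2] at h5
    have h6 := map_add_le_add q' (ψ (k + i) - T ((k + i : ℕ) * h) x)
      (T ((k + i : ℕ) * h) x - T (k * h) x)
    rw [sub_add_sub_cancel] at h6
    nlinarith
  have hAv : ∀ k : ℕ, k * h ≤ S → q' (diffQuot F h (v k) - T (k * h) z) ≤ 2 * ε := by
    intro k hk
    simp only [v, map_smul, map_sum]
    refine seminorm_avg_sub_le q' hM fun i hi => ?_
    obtain ⟨h1, h2, h3⟩ := htime k hk i hi.le
    have h4 := (hψ (k + i) h1).2
    have h5 := hτz _ hk _ h3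
    rw [← h2] at h5
    have h6 := map_add_le_add q' (diffQuot F h (ψ (k + i)) - T ((k + i : ℕ) * h) z)
      (T ((k + i : ℕ) * h) z - T (k * h) z)
    rw [sub_add_sub_cancel] at h6
    linarith
  have hh' : ((h : ℝ) : 𝕜) ≠ 0 := by simpa using hh.1.ne'
  have hM' : (M : 𝕜) ≠ 0 := by exact_mod_cast hM.ne'
  -- Averages over consecutive windows differ only by the two end terms.
  have hinc : ∀ k, v (k + 1) - v k = (M : 𝕜)⁻¹ • (ψ (k + M) - ψ k) := by
    intro k
    simp only [v, ← smul_sub]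
    congr 1
    have h1 := Finset.sum_range_succ (fun i => ψ (k + i)) M
    rw [Finset.sum_range_succ'] at h1
    have h2 : ∑ i ∈ Finset.range M, ψ (k + 1 + i) = ∑ i ∈ Finset.range M, ψ (k + (i + 1)) :=
      Finset.sum_congr rfl fun i _ => by rw [add_assoc, add_comm 1 i]
    rw [h2, eq_sub_of_add_eq h1, add_zero]
    abel
  have hslope : ∀ k : ℕ, k * h ≤ S →
      q' (((h : ℝ) : 𝕜)⁻¹ • (v (k + 1) - v k) - T (k * h) z) ≤ 2 * ε := by
    intro k hk
    obtain ⟨h1, h2, h3⟩ := htime k hk M le_rfl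
    have h4 := (hψ (k + M) h1).1
    have h5 := (hψ k (hk.trans (by simp))).1
    have hmv := hT.slope_sub_le hp (hT.apply_mem_strongDerivGraph hxz (k * h)) hq' hMh0
      (y := T (k * h) z) (c := ε) (fun s hs => by
        rw [← mul_apply_eq_comp, ← hT.map_add, add_comm]
        exact hτz _ hk _ (hs.trans hMτ))
    rw [← mul_apply_eq_comp, ← hT.map_add, add_comm (M * h), ← h2] at hmv
    have e : ((h : ℝ) : 𝕜)⁻¹ • (v (k + 1) - v k) - T (k * h) z
        = (((M * h : ℝ≥0) : ℝ) : 𝕜)⁻¹ • ((ψ (k + M) - T ((k + M : ℕ) * h) x) - (ψ k - T (k * h) x))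
          + ((((M * h : ℝ≥0) : ℝ) : 𝕜)⁻¹ • (T ((k + M : ℕ) * h) x - T (k * h) x)
            - T (k * h) z) := by
      rw [hinc, smul_smul, ← add_sub_assoc, ← smul_add]
      congr 2
      · push_cast
        rw [mul_inv, mul_comm]
      · abel
    rw [e]
    refine (map_add_le_add _ _ _).trans ?_
    have h6 : q' ((((M * h : ℝ≥0) : ℝ) : 𝕜)⁻¹ •
        ((ψ (k + M) - T ((k + M : ℕ) * h) x) - (ψ k - T (k * h) x))) ≤ ε := by
      rw [map_smul_eq_mul, norm_inv, norm_coe_nnreal, inv_mul_le_iff₀ (by exact_mod_cast hMh0)]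
      refine (map_sub_le_add _ _ _).trans ?_
      nlinarith
    linarith
  have hstep : ∀ k < m, q' (F h (v k) - v (k + 1)) ≤ h * (4 * ε) := by
    intro k hk
    have hk' : k * h ≤ S := le_trans (by gcongr) hm
    have e : F h (v k) - v (k + 1) = ((h : ℝ) : 𝕜) • ((diffQuot F h (v k) - T (k * h) z)
        - (((h : ℝ) : 𝕜)⁻¹ • (v (k + 1) - v k) - T (k * h) z)) := by
      rw [sub_sub_sub_cancel_right, diffQuot, _root_.smul_apply, ← smul_sub, smul_inv_smul₀ hh',
        hF.map_zero, _root_.sub_apply, one_apply_eq_self]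
      abel
    rw [e, map_smul_eq_mul, norm_coe_nnreal]
    gcongr
    refine (map_sub_le_add _ _ _).trans ?_
    linarith [hAv k hk', hslope k hk']
  have htel := pow_apply_sub_le (v := v) (fun j hj => hb h j (le_trans (by gcongr) hm)) hstep
  have hm' : (m : ℝ) * h ≤ S := by exact_mod_cast hm
  have e : (F h ^ m) x - T (m * h) x = ((F h ^ m) (x - v 0) + ((F h ^ m) (v 0) - v m))
      + (v m - T (m * h) x) := by
    rw [map_sub]
    abel
  rw [e]
  have h1 := map_add_le_add q ((F h ^ m) (x - v 0) + ((F h ^ m) (v 0) - v m))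
    (v m - T (m * h) x)
  have h2 := map_add_le_add q ((F h ^ m) (x - v 0)) ((F h ^ m) (v 0) - v m)
  have h3 : q ((F h ^ m) (x - v 0)) ≤ 2 * ε := by
    refine (hb h m hm _).trans ?_
    rw [map_sub_rev q']
    simpa [hT.map_zero] using hv 0 (by simp)
  have h4 := (hqq' _).trans (hv m hm)
  nlinarith

theorem eventually_pow_sub_le_of_dense (hp : WithSeminorms p) (hT : IsLC0Semigroup p T)
    (hF : MemE p F)
    (hTF : (strongDerivGraph T : Set (X × X)) ⊆ closure (mefDeriv F : Set (X × X)))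
    (hd : Dense {x | ∃ z, (x, z) ∈ strongDerivGraph T}) (f : X) {q : Seminorm 𝕜 X}
    (hq : Continuous q) (S : ℝ≥0) {ε : ℝ} (hε : 0 < ε) :
    ∀ᶠ h in 𝓝[>] (0 : ℝ≥0), ∀ m : ℕ, m * h ≤ S → q ((F h ^ m) f - T (m * h) f) ≤ ε := by
  obtain ⟨q₁, hq₁, hb₁⟩ := hF.exists_bound hp hq S
  obtain ⟨q₂, hq₂, hb₂⟩ := hT.exists_bound hp hq S
  have hq₁₂ : Continuous (q₁ + q₂) := hq₁.add hq₂
  obtain ⟨x, ⟨z, hxz⟩, hxf⟩ :=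
    exists_seminorm_sub_lt_of_mem_closure (hd f) hq₁₂ (half_pos hε)
  filter_upwards [eventually_pow_sub_le_of_mem_graph hp hT hF hTF hxz hq S
    (by positivity : 0 < ε / (8 * (S + 1)))] with h H m hm
  have h0 : 4 * (S : ℝ) * (ε / (8 * (S + 1))) + 4 * (ε / (8 * (S + 1))) = ε / 2 := by
    field_simp
    ring
  have h1 := H m hm
  rw [h0] at h1
  have e : (F h ^ m) f - T (m * h) f
      = ((F h ^ m) x - T (m * h) x) - ((F h ^ m) (x - f) - T (m * h) (x - f)) := by
    simp only [map_sub]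
    abel
  rw [e]
  have h2 := map_sub_le_add q ((F h ^ m) x - T (m * h) x)
    ((F h ^ m) (x - f) - T (m * h) (x - f))
  have h3 := map_sub_le_add q ((F h ^ m) (x - f)) (T (m * h) (x - f))
  have h4 := hb₁ h m hm (x - f)
  have h5 := hb₂ (m * h) hm (x - f)
  have h6 : q₁ (x - f) + q₂ (x - f) < ε / 2 := hxf
  linarith

end Chernoff

end LocallyConvexChernoff

open LocallyConvexChernoff in
theorem theorem6p1 {𝕜 X Ω : Type*} [RCLike 𝕜] [AddCommGroup X] [Module 𝕜 X]
    [UniformSpace X] [IsUniformAddGroup X] [ContinuousSMul 𝕜 X] [T2Space X]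
    (p : SeminormFamily 𝕜 X Ω) (hp : WithSeminorms p) (hX : SeqComplete X)
    (T : ℝ≥0 → X →L[𝕜] X) (Z : X →ₗ.[𝕜] X) (hZ : IsGenerator p T Z)
    (D : Set X) (hD : IsCore Z D)
    (F : ℝ≥0 → X →L[𝕜] X) (hF : MemF p F)
    (hFZ : ∀ f : Z.domain, (f : X) ∈ D →
      ∃ hf : (f : X) ∈ (effDeriv F).domain, effDeriv F ⟨f, hf⟩ = Z f) :
    ∀ f : X, ∀ t₀ : ℝ≥0, 0 < t₀ →
      TendstoUniformlyOn (fun (n : ℕ) (t : ℝ≥0) => (F (t / n) ^ n) f) (fun t => T t f)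
        atTop (Icc 0 t₀) := by
  have hT := hZ.semigroup
  have hTF : (strongDerivGraph T : Set (X × X)) ⊆ closure (mefDeriv F : Set (X × X)) := by
    intro a ha
    have ha' : a ∈ (Z.graph : Set (X × X)) := by
      rw [hZ.eq_strongDeriv]
      exact (mem_graph_strongDeriv T a).2 ha
    rw [← hD.closure_eq] at ha'
    refine closure_mono ?_ ha'
    rintro _ ⟨x, hx, rfl⟩
    obtain ⟨hf, he⟩ := hFZ x hx
    exact hF.mem_mefDeriv_of_effDeriv_eq hp hf he
  intro f t₀ ht₀ V hV
  obtain ⟨q, hq, r, hr, hqV⟩ := exists_seminorm_of_mem_uniformity hp hV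
  have hev := eventually_pow_sub_le_of_dense hp hT hF.memE hTF (hT.dense_domain hp hX) f hq t₀
    (half_pos hr)
  obtain ⟨h₀, hh₀, H⟩ := mem_nhdsGT_iff_exists_Ioc_subset.1 hev
  filter_upwards [eventually_gt_atTop 0,
    (tendsto_div_natCast_zero t₀).eventually (ge_mem_nhds hh₀)] with n hn hn₀ t ht
  refine hqV _ _ (lt_of_le_of_lt ?_ (half_lt_self hr))
  rcases (zero_le : 0 ≤ t).eq_or_lt with rfl | ht0
  · simpa [hF.memE.map_zero, hT.map_zero] using (half_pos hr).le
  have hn' : (0 : ℝ≥0) < n := by exact_mod_cast hn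
  have hnt : n * (t / n) = t := mul_div_cancel₀ t hn'.ne'
  have hmem : t / n ∈ Ioc 0 h₀ :=
    ⟨div_pos ht0 hn', le_trans (by gcongr; exact ht.2) hn₀⟩
  have := H hmem n (hnt.le.trans ht.2)
  rwa [hnt] at this
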